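/- **Setting.** Let $\mathcal{M}=(S,\mathrm{Act},P,\iota)$ be a finite Markov decision process: $S$ is a finite set of states, $\mathrm{Act}(s)$ is a finite non-empty set of actions for each $s\in S$, the transition weights $P(s,\alpha,t)\ge 0$ satisfy $\sum_t P(s,\alpha,t)\le 1$ for $\alpha\in\mathrm{Act}(s)$, and the initial weights $\iota(s)\ge 0$ satisfy $\sum_s\iota(s)\le 1$. Let $\mathrm{Goal}\subseteq S$ be a set of trap states ($P(g,\alpha,t)=0$ for all $g\in\mathrm{Goal}$, $\alpha\in\mathrm{Act}(g)$, $t\in S$). For $v\in\{\min,\max\}$, $\mathbf{Pr}^{v}_{\mathcal{M}}(\lozenge\mathrm{Goal})$ is the infimum, respectively supremum, over all (deterministic, history-dependent) schedulers of the probability to reach $\mathrm{Goal}$. The underlying graph has an edge $s\to t$ iff $P(s,\alpha,t)>0$ for some $\alpha\in\mathrm{Act}(s)$; $\mathrm{reach}(I)$ is the set of states reachable from $I\subseteq S$ (including $I$). For $T\subseteq S$ the induced subsystem $\mathcal{M}_T$ has state set $T$ and the transition and initial weights of $\mathcal{M}$ restricted to $T$. It is a *witness* for $\mathbf{Pr}^{v}(\lozenge\mathrm{Goal})\ge\lambda$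 if $\mathbf{Pr}^{v}_{\mathcal{M}_T}(\lozenge\mathrm{Goal})\ge\lambda$. For $q\in T$ let $v_T(q)$ be $\mathbf{Pr}^{v}(\lozenge\mathrm{Goal})$ in $\mathcal{M}_T$ with initial distribution replaced by the Dirac distribution on $q$. Let $\mathcal{P}$ be a partition of $S$ into non-empty blocks that is a *directed tree partition*: the graph on the blocks with an edge $B\to C$ iff $B\ne C$ and there is an edge from a state of $B$ to a state of $C$ is a directed tree (its underlying undirected graph is a tree, there are no antiparallel edges, and every block has in-degree at most one). Assume that every block is either contained in $\mathrm{Goal}$ or disjoint from it, and that all states $s$ with $\iota(s)>0$ lie in the root block. For a block $B$ let $\mathrm{inc}(B)$ be the set of states of $B$ that are initial or have an incoming edge from a state of the parent block of $B$; let $\mathrm{out}(B)$ be the union of $\mathrm{inc}(C)$ over the children $C$ of $B$; and let $\mathrm{cl}(B)$ be the union of all blocks reachable from $B$ in the tree (including $B$). **Domination.** Let $I\subseteq S$. A *partial subsystem* for $I$ is a set $T\subseteq\mathrm{reach}(I)$. For $T\subseteq S$ the *$I$-point* $\mathrm{val}^v_I(T)\in\mathbb{R}^I$ has entries $v_T(q)$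 for $q\in T\cap I$ and $0$ for $q\in I\setminus T$. For $\theta\in\mathbb{R}^I$ let $\pi(\theta)$ be the set of all vectors obtained from $\theta$ by choosing $D\subseteq I$ and setting all entries outside $D$ to $0$. A set $\mathcal{S}$ of partial subsystems *dominates* $T$ (with respect to $v$ and $I$) if there is $\mathcal{S}'\subseteq\mathcal{S}$ such that $|T'|\le|T|$ for all $T'\in\mathcal{S}'$ and $\mathrm{val}^v_I(T)$ is a convex combination of elements of $\bigcup_{T'\in\mathcal{S}'}\pi(\mathrm{val}^v_I(T'))$. It *strongly dominates* $T$ if some singleton $\{T'\}\subseteq\mathcal{S}$ dominates $T$. **Statement.** Let $\lambda\in[0,1]$, let $B\in\mathcal{P}$, let $S'\subseteq S$, $S_2=S'\cap(\mathrm{cl}(B)\setminus B)$ and $S_1=S'\setminus S_2$, put $I=\mathrm{out}(B)$, and let $\mathcal{S}$ be a set of partial subsystems for $I$. 1. If $\mathcal{M}_{S'}$ is a witness for $\mathbf{Pr}^{\min}(\lozenge\mathrm{Goal})\ge\lambda$ and $\mathcal{S}$ strongly dominates $S_2$ (with respect to $v=\min$), then there is $T\in\mathcal{S}$ with $|T|\le|S_2|$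 such that $\mathcal{M}_{S_1\cup T}$ is a witness for $\mathbf{Pr}^{\min}(\lozenge\mathrm{Goal})\ge\lambda$. 2. If $\mathcal{M}_{S'}$ is a witness for $\mathbf{Pr}^{\max}(\lozenge\mathrm{Goal})\ge\lambda$ and $\mathcal{S}$ dominates $S_2$ (with respect to $v=\max$), then there is $T\in\mathcal{S}$ with $|T|\le|S_2|$ such that $\mathcal{M}_{S_1\cup T}$ is a witness for $\mathbf{Pr}^{\max}(\lozenge\mathrm{Goal})\ge\lambda$. -/

import Mathlib

open MeasureTheory ProbabilityTheory
open scoped NNReal ENNReal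

/-- A finite sub-stochastic Markov decision process with a distinguished set of trap states `Goal`.
`Act s` is the (finite, non-empty) set of actions enabled in `s`. -/
structure MDP (S A : Type*) [Fintype S] where
  Act : S → Finset A
  act_nonempty : ∀ s, (Act s).Nonempty
  P : S → A → S → ℝ≥0
  P_sum_le : ∀ s, ∀ a ∈ Act s, ∑ t, P s a t ≤ 1
  ι : S → ℝ≥0
  ι_sum_le : ∑ s, ι s ≤ 1
  Goal : Set S
  goal_trap : ∀ g ∈ Goal, ∀ a ∈ Act g, ∀ t, P g a t = 0

/-- The two optimisation directions. -/
inductive Opt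
  | min
  | max

/-- States of the Markov chain induced by a scheduler: a finite path
`s₀ a₀ s₁ a₁ … sₙ`, given by the list `[(s₀, a₀), …, (sₙ₋₁, aₙ₋₁)]` and its last state `sₙ`,
or the additional state `fail`, which carries the probability missing in the sub-stochastic
system. -/
inductive ChainState (S A : Type*)
  | fail : ChainState S A
  | path (h : List (S × A)) (s : S) : ChainState S A

instance (S A : Type*) : MeasurableSpace (ChainState S A) := ⊤

instance (S A : Type*) : DiscreteMeasurableSpace (ChainState S A) := ⟨fun _ => trivial⟩

/-- Completion of a sub-distribution `w` to a distribution; `none` gets the missing mass. -/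
noncomputable def completePMF {S : Type*} [Fintype S] (w : S → ℝ≥0) (hw : ∑ s, w s ≤ 1) :
    PMF (Option S) :=
  PMF.ofFintype (fun o => o.elim (1 - ∑ s, (w s : ℝ≥0∞)) (fun s => (w s : ℝ≥0∞))) (by
    have h : ∑ s, (w s : ℝ≥0∞) ≤ 1 := by exact_mod_cast hw
    rw [Fintype.sum_option]
    exact tsub_add_cancel_of_le h)

namespace MDP

section Basic

variable {S A : Type*} [Fintype S] (M : MDP S A)

/-- A (deterministic, history-dependent) scheduler: it maps each finite path
`s₀ a₀ … sₙ₋₁ aₙ₋₁ sₙ` (given as for `ChainState`) to an action that is enabled in `sₙ`. -/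
structure Scheduler where
  choose : List (S × A) → S → A
  choose_mem : ∀ h s, choose h s ∈ M.Act s

variable {M} in
/-- One step of the Markov chain induced by the scheduler `σ`. -/
noncomputable def Scheduler.step (σ : M.Scheduler) : ChainState S A → PMF (ChainState S A)
  | .fail => PMF.pure .fail
  | .path h s =>
      (completePMF (M.P s (σ.choose h s)) (M.P_sum_le s _ (σ.choose_mem h s))).map
        (fun o => o.elim .fail (fun t => .path (h ++ [(s, σ.choose h s)]) t))

/-- The initial distribution of the induced Markov chain. -/
noncomputable def initDist : PMF (ChainState S A) :=
  (completePMF M.ι M.ι_sum_le).map (fun o => o.elim .fail (fun s => .path [] s))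

variable {M} in
/-- The step of the induced chain, as the kernel that depends on the last entry of a history. -/
noncomputable def Scheduler.kernel (σ : M.Scheduler) (n : ℕ) :
    Kernel ((i : Finset.Iic n) → ChainState S A) (ChainState S A) where
  toFun x := (σ.step (x ⟨n, Finset.mem_Iic.2 le_rfl⟩)).toMeasure
  measurable' :=
    (Measurable.of_discrete (f := fun y : ChainState S A => (σ.step y).toMeasure)).comp
      (measurable_pi_apply _)

instance (σ : M.Scheduler) (n : ℕ) : IsMarkovKernel (σ.kernel n) :=
  ⟨fun x => inferInstanceAs
    (IsProbabilityMeasure (σ.step (x ⟨n, Finset.mem_Iic.2 le_rfl⟩)).toMeasure)⟩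

variable {M} in
/-- The probability measure on the runs of the Markov chain induced by `σ`. -/
noncomputable def Scheduler.measure (σ : M.Scheduler) : Measure (ℕ → ChainState S A) :=
  Kernel.trajMeasure (X := fun _ => ChainState S A) M.initDist.toMeasure σ.kernel

/-- The runs that visit `Goal`. -/
def eventuallyGoal : Set (ℕ → ChainState S A) :=
  {ω | ∃ n h g, g ∈ M.Goal ∧ ω n = .path h g}

variable {M} in
/-- The probability to reach `Goal` under the scheduler `σ`. -/
noncomputable def Scheduler.reachProb (σ : M.Scheduler) : ℝ :=
  σ.measure.real M.eventuallyGoal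

/-- Minimal, respectively maximal, probability to reach `Goal`. -/
noncomputable def pr : Opt → ℝ
  | .min => ⨅ σ : M.Scheduler, σ.reachProb
  | .max => ⨆ σ : M.Scheduler, σ.reachProb

/-- The edge relation of the underlying graph. -/
def Edge (s t : S) : Prop := ∃ a ∈ M.Act s, 0 < M.P s a t

/-- The states reachable from `I` in the underlying graph (including `I` itself). -/
def reach (I : Set S) : Set S := {t | ∃ s ∈ I, Relation.ReflTransGen M.Edge s t}

variable [DecidableEq S]

/-- The MDP `M` with the Dirac distribution on `s` as initial distribution. -/
def startAt (s : S) : MDP S A :=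
  { M with
    ι := Pi.single s 1
    ι_sum_le := by simp }

/-- The subsystem induced by a set `T` of states. -/
def induced (T : Finset S) : MDP T A where
  Act s := M.Act s
  act_nonempty s := M.act_nonempty s
  P s a t := M.P s a t
  P_sum_le s a ha :=
    (Finset.sum_coe_sort T (fun t => M.P s a t)).trans_le
      ((Finset.sum_le_sum_of_subset (Finset.subset_univ T)).trans (M.P_sum_le s a ha))
  ι s := M.ι s
  ι_sum_le :=
    (Finset.sum_coe_sort T M.ι).trans_le
      ((Finset.sum_le_sum_of_subset (Finset.subset_univ T)).trans M.ι_sum_le)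
  Goal := {s | (s : S) ∈ M.Goal}
  goal_trap g hg a ha t := M.goal_trap g hg a ha t

/-- The subsystem induced by `T` is a witness for `Pr^v_M(◇ Goal) ≥ lam`. -/
def IsWitness (v : Opt) (lam : ℝ) (T : Finset S) : Prop := lam ≤ (M.induced T).pr v

/-- `M.val v T q` is the value of the state `q ∈ T` in the subsystem induced by `T`. -/
noncomputable def val (v : Opt) (T : Finset S) (q : T) : ℝ := ((M.induced T).startAt q).pr v

/-! ### Partial subsystems and domination -/

/-- A partial subsystem for `I`. -/
def IsPartialSubsystem (I : Set S) (T : Finset S) : Prop := (T : Set S) ⊆ M.reach I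

/-- The `I`-point of `T`. -/
noncomputable def point (v : Opt) (I : Set S) (T : Finset S) : I → ℝ :=
  fun q => if h : (q : S) ∈ T then M.val v T ⟨q, h⟩ else 0

/-- The projections of `θ` onto subsets of the axes. -/
def projections {I : Set S} (θ : I → ℝ) : Set (I → ℝ) :=
  {x | ∃ D : Set I, x = D.indicator θ}

/-- The set `𝒮` dominates `T` (with respect to the interface `I`). -/
def Dominates (v : Opt) (I : Set S) (𝒮 : Set (Finset S)) (T : Finset S) : Prop :=
  ∃ 𝒮' ⊆ 𝒮, (∀ T' ∈ 𝒮', T'.card ≤ T.card) ∧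
    M.point v I T ∈ convexHull ℝ (⋃ T' ∈ 𝒮', projections (M.point v I T'))

/-- The set `𝒮` strongly dominates `T` (with respect to the interface `I`). -/
def StronglyDominates (v : Opt) (I : Set S) (𝒮 : Set (Finset S)) (T : Finset S) : Prop :=
  ∃ T', {T'} ⊆ 𝒮 ∧ M.Dominates v I {T'} T

/-! ### Directed tree partitions -/

variable (Q : Finpartition (Finset.univ : Finset S))

/-- Proper edges of the quotient of the underlying graph: `C` is a child of `B`. -/
def Child (B C : Finset S) : Prop :=
  B ∈ Q.parts ∧ C ∈ Q.parts ∧ B ≠ C ∧ ∃ s ∈ B, ∃ t ∈ C, M.Edge s t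

/-- The quotient graph is a directed tree (self-loops, which stem from edges inside a block, are
disregarded): the underlying undirected graph is a tree (in particular there is no pair of
antiparallel edges), and every block has in-degree at most one. -/
def IsDirectedTreePartition : Prop :=
  (SimpleGraph.fromRel (fun B C : Q.parts => M.Child Q B C)).IsTree ∧
  (∀ B C, M.Child Q B C → ¬ M.Child Q C B) ∧
  (∀ B B' C, M.Child Q B C → M.Child Q B' C → B = B')

/-- `R` is the root block. -/
def IsRootBlock (R : Finset S) : Prop := R ∈ Q.parts ∧ ∀ B, ¬ M.Child Q B R

/-- States of `B` that are initial or have an incoming edge from the parent of `B`. -/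
def inc (B : Finset S) : Set S :=
  {s | s ∈ B ∧ (0 < M.ι s ∨ ∃ B', M.Child Q B' B ∧ ∃ t ∈ B', M.Edge t s)}

/-- Union of the sets `inc C` over the children `C` of `B`. -/
def out (B : Finset S) : Set S := {s | ∃ C, M.Child Q B C ∧ s ∈ M.inc Q C}

/-- Union of the blocks that are reachable from `B` in the tree order (including `B`). -/
def cl (B : Finset S) : Set S := {s | ∃ C, Relation.ReflTransGen (M.Child Q) B C ∧ s ∈ C}

end Basic

end MDP

/-! Optimal reachability probabilities are the least fixed point of the Bellman operator (`pr_eq`),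
so every function with Bellman image below itself bounds them from above. The rest of the argument
compares such supersolutions and never returns to schedulers.

Let `U` be the union of the strict descendants of `B`. No edge leaves `U`, every edge into it ends
in `out B`, and it carries no initial weight (`isClosedThrough_cl_diff`,
`init_eq_zero_of_mem_cl_diff`). Hence values inside `U` ignore `S₁`, and the states outside see `U`
only through the values on `out B`. Domination bounds those values for `S₂` by a weighted average of
the values for sets `V j`. Gluing the values of `S₂` on `U` to the averaged values of `S₁ ∪ V j`
outside gives a supersolution (`subValue_union_le`), so the probability for `S₁ ∪ S₂` is at most an
average of those for `S₁ ∪ V j`, and the best `j` works. The averaging step needs the optimum over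
actions to be sublinear: this holds for a supremum, while for an infimum a single `V` is used. -/

theorem lintegral_completePMF_map {S C : Type*} [Fintype S] [MeasurableSpace C]
    [DiscreteMeasurableSpace C] (w : S → ℝ≥0) (hw : ∑ s, w s ≤ 1) (g : S → C) (c : C)
    (f : C → ℝ≥0∞) (hc : f c = 0) :
    ∫⁻ x, f x ∂((completePMF w hw).map (fun o => o.elim c g)).toMeasure = ∑ t, w t * f (g t) := by
  let _ : MeasurableSpace (Option S) := ⊤
  rw [← PMF.toMeasure_map (hf := Measurable.of_discrete),
    lintegral_map Measurable.of_discrete Measurable.of_discrete, lintegral_fintype,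
    Fintype.sum_option]
  simp_rw [PMF.toMeasure_apply_singleton _ _ (MeasurableSet.of_discrete)]
  simp [hc, completePMF, mul_comm]

/-! ### Reachability probability under a fixed scheduler -/

namespace MDP

variable {S A : Type*} [Fintype S] {M : MDP S A}

namespace Scheduler

variable (σ : M.Scheduler)

/-- The expectation of `f` after one step of the induced chain. -/
noncomputable def expect (f : ChainState S A → ℝ≥0∞) (c : ChainState S A) : ℝ≥0∞ :=
  ∫⁻ y, f y ∂(σ.step c).toMeasure

theorem expect_fail (f : ChainState S A → ℝ≥0∞) : σ.expect f .fail = f .fail := by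
  rw [expect, step, PMF.toMeasure_pure, lintegral_dirac]

theorem expect_path (f : ChainState S A → ℝ≥0∞) (hf : f .fail = 0) (h : List (S × A)) (s : S) :
    σ.expect f (.path h s) =
      ∑ t, M.P s (σ.choose h s) t * f (.path (h ++ [(s, σ.choose h s)]) t) := by
  rw [expect, step, lintegral_completePMF_map _ _ _ _ _ hf]

theorem lintegral_measure_zero (f : ChainState S A → ℝ≥0∞) (hf : f .fail = 0) :
    ∫⁻ ω, f (ω 0) ∂σ.measure = ∑ s, M.ι s * f (.path [] s) := by
  have hmap : σ.measure.map (fun ω => ω 0) = M.initDist.toMeasure := by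
    have h0 : (fun ω : ℕ → ChainState S A => ω 0) =
        (fun x : (i : Finset.Iic 0) → ChainState S A => x ⟨0, by simp⟩) ∘
          Preorder.frestrictLe (π := fun _ => ChainState S A) 0 := rfl
    rw [h0, ← Measure.map_map (by fun_prop) (by fun_prop), measure, Kernel.trajMeasure,
      Measure.map_comp _ _ (by fun_prop), Kernel.traj_map_frestrictLe, Kernel.partialTraj_self,
      Measure.id_comp, Measure.map_map (by fun_prop) (by fun_prop)]
    exact Measure.map_id
  rw [← lintegral_completePMF_map M.ι M.ι_sum_le (fun s => .path [] s) _ f hf, ← initDist, ← hmap,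
    lintegral_map Measurable.of_discrete (by fun_prop)]

/-- The Markov property. The factor `f` allows conditioning on the state at time `n`, as needed for
`ae_succ_eq_fail`. -/
theorem lintegral_measure_mul_succ (n : ℕ) (f g : ChainState S A → ℝ≥0∞) :
    ∫⁻ ω, f (ω n) * g (ω (n + 1)) ∂σ.measure = ∫⁻ ω, f (ω n) * σ.expect g (ω n) ∂σ.measure := by
  have key := Kernel.map_frestrictLe_trajMeasure_compProd_eq_map_trajMeasure
    (X := fun _ => ChainState S A) (μ₀ := M.initDist.toMeasure) (κ := σ.kernel) (a := n)
  have hf : Measurable f := Measurable.of_discrete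
  have hg : Measurable g := Measurable.of_discrete
  let last (x : (i : Finset.Iic n) → ChainState S A) : ChainState S A :=
    x ⟨n, Finset.mem_Iic.2 le_rfl⟩
  have hlast : Measurable last := measurable_pi_apply _
  let F : ((i : Finset.Iic n) → ChainState S A) × ChainState S A → ℝ≥0∞ :=
    fun p => f (last p.1) * g p.2
  have hF : Measurable F := by fun_prop
  calc ∫⁻ ω, f (ω n) * g (ω (n + 1)) ∂σ.measure
      = ∫⁻ p, F p ∂(σ.measure.map
          (fun ω => (Preorder.frestrictLe (π := fun _ => ChainState S A) n ω, ω (n + 1)))) := by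
        rw [lintegral_map hF (by fun_prop)]; rfl
    _ = _ := by
        rw [measure, ← key, Measure.lintegral_compProd hF, lintegral_map _ (by fun_prop)]
        · refine lintegral_congr fun ω => ?_
          exact lintegral_const_mul (f (ω n)) hg
        · exact hF.lintegral_kernel_prod_right'

theorem lintegral_measure_eq (f : ChainState S A → ℝ≥0∞) (hf : f .fail = 0) (n : ℕ) :
    ∫⁻ ω, f (ω n) ∂σ.measure = ∑ s, M.ι s * (σ.expect^[n] f) (.path [] s) := by
  induction n generalizing f with
  | zero => exact σ.lintegral_measure_zero f hf
  | succ n ih =>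
    have h := σ.lintegral_measure_mul_succ n 1 f
    simp only [Pi.one_apply, one_mul] at h
    rw [h, ih _ (by rw [expect_fail, hf]), Function.iterate_succ_apply]

/-- The indicator function of the paths that end in `Goal`. -/
noncomputable def goalIndicator (M : MDP S A) : ChainState S A → ℝ≥0∞
  | .fail => 0
  | .path _ s => M.Goal.indicator 1 s

/-- The conditional probability to reach `Goal` after the path `h`, `s`. -/
noncomputable def valueFrom (h : List (S × A)) (s : S) : ℝ≥0∞ :=
  ∑' n, (σ.expect^[n] (goalIndicator M)) (.path h s)

theorem expect_iterate_fail (n : ℕ) : (σ.expect^[n] (goalIndicator M)) .fail = 0 := by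
  induction n with
  | zero => rfl
  | succ n ih => rw [Function.iterate_succ_apply', expect_fail, ih]

/-- Approximations of `valueFrom`: the probability to reach `Goal` in fewer than `n` steps. -/
noncomputable def stepValue (n : ℕ) (h : List (S × A)) (s : S) : ℝ≥0∞ :=
  ∑ k ∈ Finset.range n, (σ.expect^[k] (goalIndicator M)) (.path h s)

theorem stepValue_zero (h : List (S × A)) (s : S) : σ.stepValue 0 h s = 0 := by
  simp [stepValue]

theorem stepValue_succ (n : ℕ) (h : List (S × A)) (s : S) :
    σ.stepValue (n + 1) h s = M.Goal.indicator 1 s +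
      ∑ t, M.P s (σ.choose h s) t * σ.stepValue n (h ++ [(s, σ.choose h s)]) t := by
  rw [stepValue, Finset.sum_range_succ', add_comm]
  congr 1
  simp_rw [Function.iterate_succ_apply', expect_path _ _ (σ.expect_iterate_fail _), stepValue,
    Finset.mul_sum]
  exact Finset.sum_comm

theorem valueFrom_le_iff {h : List (S × A)} {s : S} {x : ℝ≥0∞} :
    σ.valueFrom h s ≤ x ↔ ∀ n, σ.stepValue n h s ≤ x := by
  rw [valueFrom, ENNReal.tsum_eq_iSup_nat, iSup_le_iff]; rfl

theorem stepValue_le_valueFrom (n : ℕ) (h : List (S × A)) (s : S) :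
    σ.stepValue n h s ≤ σ.valueFrom h s := σ.valueFrom_le_iff.1 le_rfl n

theorem valueFrom_eq (h : List (S × A)) (s : S) :
    σ.valueFrom h s = M.Goal.indicator 1 s +
      ∑ t, M.P s (σ.choose h s) t * σ.valueFrom (h ++ [(s, σ.choose h s)]) t := by
  rw [valueFrom, tsum_eq_zero_add' ENNReal.summable]
  · congr 1
    simp_rw [Function.iterate_succ_apply', expect_path _ _ (σ.expect_iterate_fail _), valueFrom,
      ← ENNReal.tsum_mul_left]
    exact Summable.tsum_finsetSum fun _ _ => ENNReal.summable

/-- All weights out of a goal state vanish, so the completed step sends its whole mass to `fail`,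
which is absorbing. -/
theorem ae_succ_eq_fail : ∀ᵐ ω ∂σ.measure, ∀ n,
    (ω n = .fail ∨ goalIndicator M (ω n) ≠ 0) → ω (n + 1) = .fail := by
  classical
  rw [ae_all_iff]
  intro n
  let f : ChainState S A → ℝ≥0∞ := fun c => if c = .fail ∨ goalIndicator M c ≠ 0 then 1 else 0
  let g : ChainState S A → ℝ≥0∞ := fun c => if c = .fail then 0 else 1
  have hf : Measurable f := Measurable.of_discrete
  have hg : Measurable g := Measurable.of_discrete
  have hzero : ∫⁻ ω, f (ω n) * g (ω (n + 1)) ∂σ.measure = 0 := by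
    rw [σ.lintegral_measure_mul_succ n f g]
    suffices ∀ c, f c * σ.expect g c = 0 by simp [this]
    intro c
    by_cases hc : c = .fail ∨ goalIndicator M c ≠ 0
    · suffices σ.expect g c = 0 by simp [this]
      cases c with
      | fail => simp [expect_fail, g]
      | path h s =>
        have hs : s ∈ M.Goal := by
          by_contra hs
          simp [goalIndicator, hs] at hc
        rw [expect_path _ _ (by simp [g])]
        simp [M.goal_trap s hs _ (σ.choose_mem h s)]
    · simp [f, hc]
  rw [lintegral_eq_zero_iff (by fun_prop)] at hzero
  filter_upwards [hzero] with ω hω h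
  by_contra hne
  simp [f, g, h, hne] at hω

/-- Almost every run visits `Goal` at most once, so the visits at distinct times are almost disjoint
events and their probabilities add up to the series in `valueFrom`. -/
theorem measure_eventuallyGoal :
    σ.measure M.eventuallyGoal = ∑ s, M.ι s * σ.valueFrom [] s := by
  let E (n : ℕ) : Set (ℕ → ChainState S A) := {ω | goalIndicator M (ω n) ≠ 0}
  have hmeas : Measurable (goalIndicator M) := Measurable.of_discrete
  have hE : M.eventuallyGoal = ⋃ n, E n := by
    ext ω
    simp only [eventuallyGoal, Set.mem_ofPred_eq, Set.mem_iUnion, E]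
    refine exists_congr fun n => ?_
    cases hω : ω n <;> simp [goalIndicator]
  have hEm (n : ℕ) : MeasurableSet (E n) :=
    (hmeas.comp (measurable_pi_apply n)) (measurableSet_singleton 0).compl
  have hμ (n : ℕ) : σ.measure (E n) = ∫⁻ ω, goalIndicator M (ω n) ∂σ.measure := by
    rw [← lintegral_indicator_one (hEm n)]
    refine lintegral_congr fun ω => ?_
    by_cases h : ω ∈ E n
    · rw [Set.indicator_of_mem h]
      simp only [E, Set.mem_ofPred_eq] at h
      cases hω : ω n with
      | fail => simp [hω, goalIndicator] at h
      | path l s =>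
        rw [hω] at h
        simp only [goalIndicator, ne_eq, Set.indicator_apply_eq_zero, not_forall] at h
        simp [goalIndicator, h.1]
    · rw [Set.indicator_of_notMem h]
      simpa [E, eq_comm] using h
  have hfail : ∀ᵐ ω ∂σ.measure, ∀ n, ω ∈ E n → ∀ k, ω (n + 1 + k) = .fail := by
    filter_upwards [σ.ae_succ_eq_fail] with ω hω n hn k
    induction k with
    | zero => exact hω n (.inr hn)
    | succ k ih => exact hω _ (.inl ih)
  have hlt : ∀ m n, m < n → AEDisjoint σ.measure (E m) (E n) := by
    intro m n hmn
    obtain ⟨k, rfl⟩ := Nat.exists_eq_add_of_le hmn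
    refine measure_mono_null (t := {ω | ¬ ∀ n, ω ∈ E n → ∀ k, ω (n + 1 + k) = .fail}) ?_ hfail
    rintro ω ⟨h1, h2⟩ h3
    have h4 := h3 m h1 k
    exact h2 (by rw [h4]; rfl)
  have hdisj : Pairwise (Function.onFun (AEDisjoint σ.measure) E) := by
    intro m n hmn
    rcases lt_or_gt_of_ne hmn with h | h
    · exact hlt m n h
    · exact (hlt n m h).symm
  rw [hE, measure_iUnion₀ hdisj fun n => (hEm n).nullMeasurableSet]
  simp_rw [hμ, σ.lintegral_measure_eq (goalIndicator M) rfl, valueFrom, ← ENNReal.tsum_mul_left]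
  exact Summable.tsum_finsetSum fun _ _ => ENNReal.summable

theorem reachProb_eq : σ.reachProb = (∑ s, M.ι s * σ.valueFrom [] s).toReal := by
  rw [reachProb, Measure.real, measure_eventuallyGoal]

end Scheduler
end MDP

/-! ### Optimum over the enabled actions -/

namespace Opt

/-- The optimum of `f` over a finite set, in the direction `v`. -/
noncomputable def opt {A : Type*} (v : Opt) (s : Finset A) (f : A → ℝ≥0∞) : ℝ≥0∞ :=
  match v with
  | min => s.inf f
  | max => s.sup f

variable {A : Type*} {s : Finset A} {f g : A → ℝ≥0∞}

theorem opt_mono (v : Opt) (h : ∀ a ∈ s, f a ≤ g a) : v.opt s f ≤ v.opt s g := by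
  cases v
  · exact Finset.inf_mono_fun h
  · exact Finset.sup_mono_fun h

theorem exists_mem_opt_eq (v : Opt) (hs : s.Nonempty) (f : A → ℝ≥0∞) :
    ∃ a ∈ s, v.opt s f = f a := by
  cases v
  · obtain ⟨a, ha, h⟩ := Finset.exists_mem_eq_inf s hs f
    exact ⟨a, ha, h⟩
  · obtain ⟨a, ha, h⟩ := Finset.exists_mem_eq_sup s hs f
    exact ⟨a, ha, h⟩

/-- The analogue for `min` fails, which is why the minimum requires strong domination. -/
theorem opt_max_sum_mul_le {J : Type*} [Fintype J] (w : J → ℝ≥0∞) (f : J → A → ℝ≥0∞) :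
    max.opt s (fun a => ∑ j, w j * f j a) ≤ ∑ j, w j * max.opt s (f j) :=
  Finset.sup_le fun _ ha =>
    Finset.sum_le_sum fun j _ => mul_le_mul_right (Finset.le_sup (f := f j) ha) _

end Opt

/-! ### Optimal probabilities as least fixed points -/

namespace MDP

section Bellman

variable {S A : Type*} [Fintype S] (M : MDP S A)

/-- The Bellman operator for the probability to reach `Goal`. -/
noncomputable def bellman (v : Opt) : (S → ℝ≥0∞) →o (S → ℝ≥0∞) where
  toFun x s := M.Goal.indicator 1 s + v.opt (M.Act s) fun a => ∑ t, M.P s a t * x t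
  monotone' x y hxy s := by
    refine add_le_add le_rfl (v.opt_mono fun a _ => Finset.sum_le_sum fun t _ => ?_)
    exact mul_le_mul_right (hxy t) _

theorem bellman_apply (v : Opt) (x : S → ℝ≥0∞) (s : S) : M.bellman v x s =
    M.Goal.indicator 1 s + v.opt (M.Act s) fun a => ∑ t, M.P s a t * x t := rfl

/-- The least fixed point of the Bellman operator. -/
noncomputable def stateValue (v : Opt) : S → ℝ≥0∞ := (M.bellman v).lfp

theorem bellman_stateValue (v : Opt) : M.bellman v (M.stateValue v) = M.stateValue v :=
  (M.bellman v).map_lfp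

variable {M} in
theorem stateValue_le {v : Opt} {x : S → ℝ≥0∞} (h : M.bellman v x ≤ x) : M.stateValue v ≤ x :=
  (M.bellman v).lfp_le h

theorem stateValue_le_one (v : Opt) : M.stateValue v ≤ 1 := by
  refine stateValue_le fun s => ?_
  rw [bellman_apply]
  obtain ⟨a, ha, h⟩ := v.exists_mem_opt_eq (M.act_nonempty s) fun a => ∑ t, (M.P s a t : ℝ≥0∞) * 1
  simp only [Pi.one_apply, h]
  by_cases hs : s ∈ M.Goal
  · simp [hs, M.goal_trap s hs a ha]
  · simpa [hs] using mod_cast M.P_sum_le s a ha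

theorem sum_init_mul_ne_top {x : S → ℝ≥0∞} (hx : x ≤ 1) : ∑ s, (M.ι s : ℝ≥0∞) * x s ≠ ⊤ :=
  ENNReal.sum_ne_top.2 fun s _ =>
    ENNReal.mul_ne_top ENNReal.coe_ne_top ((hx s).trans_lt ENNReal.one_lt_top).ne

variable {M} in
theorem Scheduler.valueFrom_le_stateValue_max (σ : M.Scheduler) (h : List (S × A)) (s : S) :
    σ.valueFrom h s ≤ M.stateValue .max s := by
  refine σ.valueFrom_le_iff.2 fun n => ?_
  induction n generalizing h s with
  | zero => simp [stepValue_zero]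
  | succ n ih =>
    rw [stepValue_succ, ← bellman_stateValue, bellman_apply]
    refine add_le_add le_rfl (le_trans (Finset.sum_le_sum fun t _ => mul_le_mul_right (ih _ t) _)
      (Finset.le_sup (f := fun a => ∑ t, M.P s a t * M.stateValue .max t) (σ.choose_mem h s)))

variable {M} in
-- Taking the infimum over histories turns the values of `σ` into a supersolution on states.
theorem Scheduler.stateValue_min_le_valueFrom (σ : M.Scheduler) (h : List (S × A)) (s : S) :
    M.stateValue .min s ≤ σ.valueFrom h s := by
  suffices H : M.stateValue .min ≤ fun s => ⨅ h, σ.valueFrom h s from (H s).trans (iInf_le _ h)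
  refine stateValue_le fun s => le_iInf fun h => ?_
  rw [valueFrom_eq, bellman_apply]
  refine add_le_add le_rfl (le_trans (Finset.inf_le (σ.choose_mem h s)) ?_)
  exact Finset.sum_le_sum fun t _ => mul_le_mul_right (iInf_le _ _) _

/-- The memoryless scheduler that picks a minimising action at the fixed point works. -/
theorem exists_scheduler_valueFrom_le_stateValue_min :
    ∃ σ : M.Scheduler, ∀ h s, σ.valueFrom h s ≤ M.stateValue .min s := by
  choose a ha hopt using fun s => Opt.min.exists_mem_opt_eq (M.act_nonempty s)
    fun a => ∑ t, M.P s a t * M.stateValue .min t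
  refine ⟨⟨fun _ => a, fun _ => ha⟩, fun h s => ?_⟩
  rw [Scheduler.valueFrom_le_iff]
  intro n
  induction n generalizing h s with
  | zero => simp [Scheduler.stepValue_zero]
  | succ n ih =>
    rw [Scheduler.stepValue_succ, ← bellman_stateValue, bellman_apply, hopt]
    exact add_le_add le_rfl (Finset.sum_le_sum fun t _ => mul_le_mul_right (ih _ t) _)

theorem monotone_bellman_iterate (v : Opt) : Monotone fun n => (M.bellman v)^[n] ⊥ :=
  Monotone.monotone_iterate_of_le_map (M.bellman v).monotone bot_le

theorem sum_mul_iSup_iterate (v : Opt) (w : S → ℝ≥0∞) :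
    ∑ t, w t * ⨆ n, (M.bellman v)^[n] ⊥ t = ⨆ n, ∑ t, w t * (M.bellman v)^[n] ⊥ t := by
  simp_rw [ENNReal.mul_iSup]
  exact ENNReal.finsetSum_iSup_of_monotone (f := fun t n => w t * (M.bellman v)^[n] ⊥ t)
    fun t _ _ hmn => mul_le_mul_right (M.monotone_bellman_iterate v hmn t) _

/-- Kleene iteration: with finitely many actions, one action is optimal for the limit, and its
finite sum commutes with the monotone supremum. -/
theorem stateValue_max_le_iSup_iterate :
    M.stateValue .max ≤ fun s => ⨆ n, (M.bellman .max)^[n] ⊥ s := by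
  refine stateValue_le fun s => ?_
  rw [bellman_apply]
  obtain ⟨a, ha, h⟩ := Opt.max.exists_mem_opt_eq (M.act_nonempty s)
    fun a => ∑ t, M.P s a t * ⨆ n, (M.bellman .max)^[n] ⊥ t
  rw [h, sum_mul_iSup_iterate, ENNReal.add_iSup]
  refine iSup_le fun n => le_iSup_of_le (n + 1) ?_
  rw [Function.iterate_succ_apply', bellman_apply]
  exact add_le_add le_rfl
    (Finset.le_sup (f := fun a => ∑ t, M.P s a t * (M.bellman .max)^[n] ⊥ t) ha)

/-- Maximising actions at the fixed point may loop forever without reaching `Goal`; actions optimal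
for a finite horizon avoid this. -/
theorem exists_scheduler_iterate_le_valueFrom (n : ℕ) :
    ∃ σ : M.Scheduler, ∀ s, (M.bellman .max)^[n] ⊥ s ≤ σ.valueFrom [] s := by
  choose a ha hopt using fun k s => Opt.max.exists_mem_opt_eq (M.act_nonempty s)
    fun a => ∑ t, M.P s a t * (M.bellman .max)^[k] ⊥ t
  -- The history length acts as a clock: the index is the horizon left after the current step.
  let σ : M.Scheduler := ⟨fun h => a (n - 1 - h.length), fun h => ha _⟩
  have key : ∀ k h s, h.length + k = n → (M.bellman .max)^[k] ⊥ s ≤ σ.stepValue k h s := by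
    intro k
    induction k with
    | zero => intro h s _; exact bot_le
    | succ k ih =>
      intro h s hk
      have hlen : n - 1 - h.length = k := by omega
      rw [Function.iterate_succ_apply', bellman_apply, hopt, Scheduler.stepValue_succ]
      have hch : σ.choose h s = a k s := by simp only [σ, hlen]
      rw [hch]
      refine add_le_add le_rfl (Finset.sum_le_sum fun t _ => mul_le_mul_right (ih _ t ?_) _)
      simp only [List.length_append, List.length_singleton]
      omega
  exact ⟨σ, fun s => (key n [] s (by simp)).trans (σ.stepValue_le_valueFrom _ _ _)⟩

theorem pr_eq (v : Opt) : M.pr v = (∑ s, M.ι s * M.stateValue v s).toReal := by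
  have hfin (σ : M.Scheduler) : ∑ s, M.ι s * σ.valueFrom [] s ≠ ⊤ :=
    M.sum_init_mul_ne_top fun s =>
      (σ.valueFrom_le_stateValue_max [] s).trans (M.stateValue_le_one .max s)
  cases v with
  | min =>
    simp_rw [pr, Scheduler.reachProb_eq]
    rw [← ENNReal.toReal_iInf hfin]
    congr 1
    refine le_antisymm ?_ (le_iInf fun σ => Finset.sum_le_sum fun s _ =>
      mul_le_mul_right (σ.stateValue_min_le_valueFrom [] s) _)
    obtain ⟨σ, hσ⟩ := M.exists_scheduler_valueFrom_le_stateValue_min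
    exact iInf_le_of_le σ (Finset.sum_le_sum fun s _ => mul_le_mul_right (hσ [] s) _)
  | max =>
    simp_rw [pr, Scheduler.reachProb_eq]
    rw [← ENNReal.toReal_iSup hfin]
    congr 1
    refine le_antisymm (iSup_le fun σ => Finset.sum_le_sum fun s _ =>
      mul_le_mul_right (σ.valueFrom_le_stateValue_max [] s) _) ?_
    refine (Finset.sum_le_sum fun s _ =>
      mul_le_mul_right (M.stateValue_max_le_iSup_iterate s) _).trans ?_
    rw [sum_mul_iSup_iterate]
    refine iSup_le fun n => ?_
    obtain ⟨σ, hσ⟩ := M.exists_scheduler_iterate_le_valueFrom n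
    exact le_iSup_of_le σ (Finset.sum_le_sum fun s _ => mul_le_mul_right (hσ s) _)

variable {M} in
theorem sum_le_sum_of_edge {s : S} {a : A} (ha : a ∈ M.Act s) {x y : S → ℝ≥0∞}
    (h : ∀ t, M.Edge s t → x t ≤ y t) :
    ∑ t, M.P s a t * x t ≤ ∑ t, M.P s a t * y t := by
  refine Finset.sum_le_sum fun t _ => ?_
  rcases (zero_le : 0 ≤ M.P s a t).eq_or_lt with h0 | h0
  · simp [← h0]
  · exact mul_le_mul_right (h t ⟨a, ha, h0⟩) _

end Bellman

/-! ### Values in induced subsystems -/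

section Subsystem

variable {S A : Type*} [Fintype S] [DecidableEq S] (M : MDP S A)

/-- The values of the states in the subsystem induced by `T`, extended by zero. -/
noncomputable def subValue (v : Opt) (T : Finset S) (s : S) : ℝ≥0∞ :=
  if h : s ∈ T then (M.induced T).stateValue v ⟨s, h⟩ else 0

theorem subValue_coe (v : Opt) (T : Finset S) (s : T) :
    M.subValue v T s = (M.induced T).stateValue v s := by simp [subValue]

theorem subValue_of_notMem (v : Opt) {T : Finset S} {s : S} (hs : s ∉ T) :
    M.subValue v T s = 0 := by simp [subValue, hs]

theorem subValue_le_one (v : Opt) (T : Finset S) (s : S) : M.subValue v T s ≤ 1 := by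
  by_cases h : s ∈ T
  · exact (M.subValue_coe v T ⟨s, h⟩).trans_le ((M.induced T).stateValue_le_one v _)
  · simp [subValue_of_notMem _ _ h]

theorem subValue_ne_top (v : Opt) (T : Finset S) (s : S) : M.subValue v T s ≠ ⊤ :=
  ((M.subValue_le_one v T s).trans_lt ENNReal.one_lt_top).ne

theorem sum_induced (v : Opt) (T : Finset S) (w : S → ℝ≥0) :
    ∑ t : T, w t * (M.induced T).stateValue v t = ∑ t, w t * M.subValue v T t := by
  simp_rw [← subValue_coe]
  rw [Finset.sum_coe_sort T (fun t => w t * M.subValue v T t)]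
  exact Finset.sum_subset (Finset.subset_univ T) fun t _ ht => by
    rw [subValue_of_notMem _ _ ht, mul_zero]

theorem subValue_of_mem (v : Opt) {T : Finset S} {s : S} (hs : s ∈ T) :
    M.subValue v T s = M.Goal.indicator 1 s +
      v.opt (M.Act s) fun a => ∑ t, M.P s a t * M.subValue v T t := by
  have h := M.subValue_coe v T ⟨s, hs⟩
  rw [← bellman_stateValue, bellman_apply] at h
  simp_rw [← sum_induced]
  exact h

variable {M} in
-- Least fixed point induction for functions on all of `S`; outside `T` nothing is required of `x`.
theorem subValue_le {v : Opt} {T : Finset S} {x : S → ℝ≥0∞}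
    (h : ∀ s ∈ T, M.Goal.indicator 1 s + (v.opt (M.Act s) fun a => ∑ t, M.P s a t * x t) ≤ x s)
    (s : S) : M.subValue v T s ≤ x s := by
  by_cases hs : s ∈ T
  · refine (M.subValue_coe v T ⟨s, hs⟩).trans_le ?_
    refine stateValue_le (M := M.induced T) (x := fun t : T => x t) (fun t => ?_) ⟨s, hs⟩
    refine le_trans ?_ (h t t.2)
    refine add_le_add le_rfl (v.opt_mono fun a _ => ?_)
    refine (Finset.sum_coe_sort T (fun u => (M.P t a u : ℝ≥0∞) * x u)).trans_le ?_
    exact Finset.sum_le_sum_of_subset (Finset.subset_univ T)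
  · simp [subValue_of_notMem _ _ hs]

theorem pr_induced (v : Opt) (T : Finset S) :
    (M.induced T).pr v = (∑ s, M.ι s * M.subValue v T s).toReal := by
  rw [pr_eq, ← sum_induced]
  rfl

theorem val_eq (v : Opt) (T : Finset S) (q : T) : M.val v T q = (M.subValue v T q).toReal := by
  rw [val, pr_eq, subValue_coe, Finset.sum_eq_single q]
  · simp [startAt]
    rfl
  · intro t _ ht
    simp [startAt, ht]
  · simp

theorem point_apply (v : Opt) (I : Set S) (T : Finset S) (q : I) :
    M.point v I T q = (M.subValue v T q).toReal := by
  rw [point]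
  split_ifs with h
  · exact M.val_eq v T ⟨q, h⟩
  · simp [subValue_of_notMem _ _ h]

variable {M} in
-- Values are nonnegative, so a projection only lowers entries; undoing the projections relaxes the
-- convex combination to an inequality.
theorem Dominates.exists_weights {v : Opt} {I : Set S} {𝒮 : Set (Finset S)} {T : Finset S}
    (h : M.Dominates v I 𝒮 T) : ∃ (J : Type) (_ : Fintype J) (w : J → ℝ≥0∞) (U : J → Finset S),
      ∑ j, w j = 1 ∧ (∀ j, U j ∈ 𝒮 ∧ (U j).card ≤ T.card) ∧
      ∀ q ∈ I, M.subValue v T q ≤ ∑ j, w j * M.subValue v (U j) q := by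
  obtain ⟨𝒮', hsub, hcard, hmem⟩ := h
  obtain ⟨J, _, w, z, hw0, hw1, hz, hsum⟩ := mem_convexHull_iff_exists_fintype.1 hmem
  have hz' : ∀ j, ∃ U ∈ 𝒮', z j ∈ projections (M.point v I U) := fun j => by
    simpa using hz j
  choose U hU hzU using hz'
  refine ⟨J, inferInstance, fun j => ENNReal.ofReal (w j), U, ?_,
    fun j => ⟨hsub (hU j), hcard _ (hU j)⟩, fun q hq => ?_⟩
  · rw [← ENNReal.ofReal_sum_of_nonneg fun j _ => hw0 j, hw1, ENNReal.ofReal_one]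
  · have hle : M.point v I T ⟨q, hq⟩ ≤ ∑ j, w j * (M.subValue v (U j) q).toReal := by
      rw [← hsum, Finset.sum_apply]
      refine Finset.sum_le_sum fun j _ => ?_
      obtain ⟨D, hD⟩ := hzU j
      rw [Pi.smul_apply, smul_eq_mul, hD]
      refine mul_le_mul_of_nonneg_left ?_ (hw0 j)
      rw [← M.point_apply v I (U j) ⟨q, hq⟩]
      refine Set.indicator_apply_le' (fun _ => le_rfl) fun _ => ?_
      rw [point_apply]
      exact ENNReal.toReal_nonneg
    rw [point_apply] at hle
    rw [← ENNReal.ofReal_toReal (M.subValue_ne_top v T q)]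
    refine (ENNReal.ofReal_le_ofReal hle).trans_eq ?_
    rw [ENNReal.ofReal_sum_of_nonneg fun j _ => mul_nonneg (hw0 j) ENNReal.toReal_nonneg]
    refine Finset.sum_congr rfl fun j _ => ?_
    rw [ENNReal.ofReal_mul (hw0 j), ENNReal.ofReal_toReal (M.subValue_ne_top v _ q)]

/-! ### Replacing the part of a subsystem inside a closed set of states -/

/-- No edge leaves `U`, and all edges into `U` from outside end in `I`. -/
structure IsClosedThrough (U I : Set S) : Prop where
  closed : ∀ s ∈ U, ∀ t, M.Edge s t → t ∈ U
  entry : ∀ s ∉ U, ∀ t ∈ U, M.Edge s t → t ∈ I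

variable {M}

namespace IsClosedThrough

variable {U I : Set S} (hUI : M.IsClosedThrough U I) {S₁ T : Finset S}
include hUI

theorem subValue_union (v : Opt) (hS₁ : ∀ s ∈ S₁, s ∉ U) {s : S} (hs : s ∈ U) :
    M.subValue v (S₁ ∪ T) s = M.subValue v T s := by
  classical
  refine le_antisymm ?_ (subValue_le (fun s hs => ?_) s)
  -- The value `⊤` makes the supersolution condition trivial outside `U`, and no edge from `U` sees
  -- it.
  · let x : S → ℝ≥0∞ := fun t => if t ∈ U then M.subValue v T t else ⊤
    suffices h : M.subValue v (S₁ ∪ T) s ≤ x s by simpa [x, hs] using h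
    refine subValue_le (fun r hr => ?_) s
    by_cases hrU : r ∈ U
    · have hrT : r ∈ T := (Finset.mem_union.1 hr).resolve_left fun h => hS₁ r h hrU
      have hx : x r = M.subValue v T r := by simp [x, hrU]
      rw [hx, M.subValue_of_mem v hrT]
      refine add_le_add le_rfl (v.opt_mono fun a ha => sum_le_sum_of_edge ha fun t ht => ?_)
      simp [x, hUI.closed r hrU t ht]
    · simp [x, hrU]
  · rw [← M.subValue_of_mem v (Finset.mem_union_right _ hs)]

/-- The glued function `x` is a supersolution: in `U` because `U` is closed, outside because edges
into `U` end in `I`, where `hI` applies. The hypothesis `hopt` isolates the only point where `min`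
and `max` differ. -/
theorem subValue_union_le (v : Opt) (hS₁ : ∀ s ∈ S₁, s ∉ U) (hT : ∀ s ∈ T, s ∈ U)
    {J : Type*} [Fintype J] {w : J → ℝ≥0∞} {V : J → Finset S} (hw : ∑ j, w j = 1)
    (hopt : ∀ (s : Finset A) (f : J → A → ℝ≥0∞),
      v.opt s (fun a => ∑ j, w j * f j a) ≤ ∑ j, w j * v.opt s (f j))
    (hI : ∀ q ∈ I, M.subValue v T q ≤ ∑ j, w j * M.subValue v (V j) q) {s : S} (hs : s ∉ U) :
    M.subValue v (S₁ ∪ T) s ≤ ∑ j, w j * M.subValue v (S₁ ∪ V j) s := by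
  classical
  let x : S → ℝ≥0∞ := fun t =>
    if t ∈ U then M.subValue v T t else ∑ j, w j * M.subValue v (S₁ ∪ V j) t
  suffices h : M.subValue v (S₁ ∪ T) s ≤ x s by simpa [x, hs] using h
  refine subValue_le (fun r hr => ?_) s
  by_cases hrU : r ∈ U
  · have hrT : r ∈ T := (Finset.mem_union.1 hr).resolve_left fun h => hS₁ r h hrU
    have hx : x r = M.subValue v T r := by simp [x, hrU]
    rw [hx, M.subValue_of_mem v hrT]
    refine add_le_add le_rfl (v.opt_mono fun a ha => sum_le_sum_of_edge ha fun t ht => ?_)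
    simp [x, hUI.closed r hrU t ht]
  · have hrS : r ∈ S₁ := (Finset.mem_union.1 hr).resolve_right fun h => hrU (hT r h)
    have hx : x r = ∑ j, w j * M.subValue v (S₁ ∪ V j) r := by simp [x, hrU]
    have hxt : ∀ t, M.Edge r t → x t ≤ ∑ j, w j * M.subValue v (S₁ ∪ V j) t := by
      intro t ht
      by_cases htU : t ∈ U
      · simpa [x, htU, hUI.subValue_union v hS₁ htU] using hI t (hUI.entry r hrU t htU ht)
      · simp [x, htU]
    rw [hx]
    calc M.Goal.indicator 1 r + (v.opt (M.Act r) fun a => ∑ t, M.P r a t * x t)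
        ≤ M.Goal.indicator 1 r + (v.opt (M.Act r) fun a =>
            ∑ j, w j * ∑ t, M.P r a t * M.subValue v (S₁ ∪ V j) t) := by
          refine add_le_add le_rfl (v.opt_mono fun a ha => (sum_le_sum_of_edge ha hxt).trans_eq ?_)
          simp_rw [Finset.mul_sum]
          rw [Finset.sum_comm]
          exact Finset.sum_congr rfl fun j _ => Finset.sum_congr rfl fun t _ => mul_left_comm _ _ _
      _ ≤ M.Goal.indicator 1 r + ∑ j, w j * (v.opt (M.Act r) fun a =>
            ∑ t, M.P r a t * M.subValue v (S₁ ∪ V j) t) :=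
          add_le_add le_rfl (hopt _ _)
      _ = ∑ j, w j * M.subValue v (S₁ ∪ V j) r := by
          simp_rw [M.subValue_of_mem v (Finset.mem_union_left _ hrS), mul_add,
            Finset.sum_add_distrib, ← Finset.sum_mul, hw, one_mul]

theorem sum_init_le (v : Opt) (hS₁ : ∀ s ∈ S₁, s ∉ U) (hT : ∀ s ∈ T, s ∈ U)
    (hinit : ∀ s ∈ U, M.ι s = 0)
    {J : Type*} [Fintype J] {w : J → ℝ≥0∞} {V : J → Finset S} (hw : ∑ j, w j = 1)
    (hopt : ∀ (s : Finset A) (f : J → A → ℝ≥0∞),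
      v.opt s (fun a => ∑ j, w j * f j a) ≤ ∑ j, w j * v.opt s (f j))
    (hI : ∀ q ∈ I, M.subValue v T q ≤ ∑ j, w j * M.subValue v (V j) q) :
    ∑ s, M.ι s * M.subValue v (S₁ ∪ T) s ≤
      ∑ j, w j * ∑ s, M.ι s * M.subValue v (S₁ ∪ V j) s := by
  simp_rw [Finset.mul_sum]
  rw [Finset.sum_comm]
  refine Finset.sum_le_sum fun s _ => ?_
  by_cases hs : s ∈ U
  · simp [hinit s hs]
  · simp_rw [mul_left_comm _ (M.ι s : ℝ≥0∞), ← Finset.mul_sum]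
    exact mul_le_mul_right (hUI.subValue_union_le v hS₁ hT hw hopt hI hs) _

end IsClosedThrough

theorem IsWitness.of_sum_le {v : Opt} {lam : ℝ} {T T' : Finset S} (h : M.IsWitness v lam T)
    (hle : ∑ s, M.ι s * M.subValue v T s ≤ ∑ s, M.ι s * M.subValue v T' s) :
    M.IsWitness v lam T' := by
  rw [IsWitness, pr_induced] at *
  exact h.trans (ENNReal.toReal_mono (M.sum_init_mul_ne_top (M.subValue_le_one v T')) hle)

/-! ### Tree partitions -/

variable {Q : Finpartition (Finset.univ : Finset S)}

/-- Follow an undirected path from the root. A step against an edge leads to the unique parent,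
through which the directed path built so far must have come, so its last edge is dropped. -/
theorem IsRootBlock.reflTransGen (htree : M.IsDirectedTreePartition Q) {R B : Finset S}
    (hR : M.IsRootBlock Q R) (hB : B ∈ Q.parts) : Relation.ReflTransGen (M.Child Q) R B := by
  obtain ⟨p⟩ := htree.1.connected.preconnected ⟨R, hR.1⟩ ⟨B, hB⟩
  suffices H : ∀ X Y : Q.parts, (SimpleGraph.fromRel fun B C : Q.parts => M.Child Q B C).Walk X Y →
      Relation.ReflTransGen (M.Child Q) R X → Relation.ReflTransGen (M.Child Q) R Y from
    H _ _ p .refl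
  intro X Y p
  induction p with
  | nil => exact id
  | cons hadj _ ih =>
    intro hX
    refine ih ?_
    rcases ((SimpleGraph.fromRel_adj _ _ _).1 hadj).2 with h | h
    · exact hX.tail h
    · rcases Relation.ReflTransGen.cases_tail hX with h' | ⟨Z, hZ, hZX⟩
      · exact absurd (h' ▸ h) (hR.2 _)
      · rwa [htree.2.2 _ _ _ h hZX]

/-- A cycle through a block passes through its unique parent, so it can be pushed up to the root,
which has no parent. -/
theorem IsRootBlock.not_transGen_self (htree : M.IsDirectedTreePartition Q) {R B : Finset S}
    (hR : M.IsRootBlock Q R) (hB : B ∈ Q.parts) : ¬ Relation.TransGen (M.Child Q) B B := by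
  induction hR.reflTransGen htree hB with
  | refl =>
    intro h
    obtain ⟨Z, _, hZ⟩ := Relation.TransGen.tail'_iff.1 h
    exact hR.2 _ hZ
  | tail _ hBC ih =>
    intro h
    obtain ⟨Z, hZ, hZC⟩ := Relation.TransGen.tail'_iff.1 h
    rw [htree.2.2 _ _ _ hZC hBC] at hZ
    exact ih hBC.1 (Relation.TransGen.head' hBC hZ)

theorem mem_cl_diff_iff (htree : M.IsDirectedTreePartition Q) {R B C : Finset S}
    (hR : M.IsRootBlock Q R) (hB : B ∈ Q.parts) (hC : C ∈ Q.parts) {s : S} (hs : s ∈ C) :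
    s ∈ M.cl Q B \ (B : Set S) ↔ Relation.TransGen (M.Child Q) B C := by
  have huniq : ∀ D ∈ Q.parts, s ∈ D → D = C := fun D hD hsD => Q.eq_of_mem_parts hD hC hsD hs
  constructor
  · rintro ⟨⟨D, hBD, hsD⟩, hsB⟩
    rcases Relation.reflTransGen_iff_eq_or_transGen.1 hBD with rfl | h
    · exact absurd hsD hsB
    · obtain ⟨Z, _, hZ⟩ := Relation.TransGen.tail'_iff.1 h
      exact huniq D hZ.2.1 hsD ▸ h
  · intro h
    refine ⟨⟨C, h.to_reflTransGen, hs⟩, fun hsB => ?_⟩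
    rw [← huniq B hB hsB] at h
    exact hR.not_transGen_self htree hB h

/-- If an edge enters a strict descendant `D` of `B` from a block `C` that is not one, then `C` is
the unique parent of `D`, which forces `C = B`. -/
theorem isClosedThrough_cl_diff (htree : M.IsDirectedTreePartition Q) {R B : Finset S}
    (hR : M.IsRootBlock Q R) (hB : B ∈ Q.parts) :
    M.IsClosedThrough (M.cl Q B \ (B : Set S)) (M.out Q B) := by
  constructor
  · intro s hs t hst
    obtain ⟨C, hC, hsC⟩ := Q.exists_mem (Finset.mem_univ s)
    obtain ⟨D, hD, htD⟩ := Q.exists_mem (Finset.mem_univ t)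
    rw [mem_cl_diff_iff htree hR hB hC hsC] at hs
    rw [mem_cl_diff_iff htree hR hB hD htD]
    by_cases hCD : C = D
    · rwa [← hCD]
    · exact hs.tail ⟨hC, hD, hCD, s, hsC, t, htD, hst⟩
  · intro s hs t ht hst
    obtain ⟨C, hC, hsC⟩ := Q.exists_mem (Finset.mem_univ s)
    obtain ⟨D, hD, htD⟩ := Q.exists_mem (Finset.mem_univ t)
    rw [mem_cl_diff_iff htree hR hB hC hsC] at hs
    rw [mem_cl_diff_iff htree hR hB hD htD] at ht
    have hCD : M.Child Q C D := ⟨hC, hD, fun h => hs (h ▸ ht), s, hsC, t, htD, hst⟩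
    obtain ⟨Z, hBZ, hZD⟩ := Relation.TransGen.tail'_iff.1 ht
    rw [htree.2.2 _ _ _ hZD hCD] at hBZ
    rcases Relation.reflTransGen_iff_eq_or_transGen.1 hBZ with h | h
    · subst h
      exact ⟨D, hCD, htD, .inr ⟨C, hCD, s, hsC, hst⟩⟩
    · exact absurd h hs

theorem init_eq_zero_of_mem_cl_diff (htree : M.IsDirectedTreePartition Q) {R B : Finset S}
    (hR : M.IsRootBlock Q R) (hB : B ∈ Q.parts) (hinit : ∀ s, 0 < M.ι s → s ∈ R) :
    ∀ s ∈ M.cl Q B \ (B : Set S), M.ι s = 0 := by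
  intro s hs
  by_contra h
  rw [mem_cl_diff_iff htree hR hB hR.1 (hinit s (pos_iff_ne_zero.2 h))] at hs
  obtain ⟨Z, _, hZ⟩ := Relation.TransGen.tail'_iff.1 hs
  exact hR.2 _ hZ

end Subsystem

end MDP

theorem mainTheorem7 {S A : Type*} [Fintype S] [DecidableEq S] (M : MDP S A)
    (Q : Finpartition (Finset.univ : Finset S)) (htree : M.IsDirectedTreePartition Q)
    (hgoal : ∀ C ∈ Q.parts, (C : Set S) ⊆ M.Goal ∨ Disjoint (C : Set S) M.Goal)
    (R : Finset S) (hR : M.IsRootBlock Q R) (hinit : ∀ s, 0 < M.ι s → s ∈ R)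
    (lam : ℝ) (hlam : lam ∈ Set.Icc (0 : ℝ) 1)
    (B : Finset S) (hB : B ∈ Q.parts)
    (S' S₁ S₂ : Finset S)
    (hS₂ : (S₂ : Set S) = (S' : Set S) ∩ (M.cl Q B \ (B : Set S)))
    (hS₁ : S₁ = S' \ S₂)
    (𝒮 : Set (Finset S)) (h𝒮 : ∀ T ∈ 𝒮, M.IsPartialSubsystem (M.out Q B) T) :
    (M.IsWitness .min lam S' → M.StronglyDominates .min (M.out Q B) 𝒮 S₂ →
      ∃ T ∈ 𝒮, M.IsWitness .min lam (S₁ ∪ T) ∧ T.card ≤ S₂.card) ∧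
    (M.IsWitness .max lam S' → M.Dominates .max (M.out Q B) 𝒮 S₂ →
      ∃ T ∈ 𝒮, M.IsWitness .max lam (S₁ ∪ T) ∧ T.card ≤ S₂.card) := by
  have hmem : ∀ s, s ∈ S₂ ↔ s ∈ S' ∧ s ∈ M.cl Q B \ (B : Set S) := fun s => by
    rw [← Finset.mem_coe, hS₂]; rfl
  have hUI := M.isClosedThrough_cl_diff htree hR hB
  have hι := M.init_eq_zero_of_mem_cl_diff htree hR hB hinit
  have hU₂ : ∀ s ∈ S₂, s ∈ M.cl Q B \ (B : Set S) := fun s hs => ((hmem s).1 hs).2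
  have hU₁ : ∀ s ∈ S₁, s ∉ M.cl Q B \ (B : Set S) := fun s hs hsU => by
    rw [hS₁, Finset.mem_sdiff] at hs
    exact hs.2 ((hmem s).2 ⟨hs.1, hsU⟩)
  have hS' : S' = S₁ ∪ S₂ := by
    rw [hS₁, Finset.sdiff_union_of_subset fun s hs => ((hmem s).1 hs).1]
  rw [hS']
  constructor
  · rintro hwit ⟨T', hT', hdom⟩
    obtain ⟨J, _, w, V, hw, hV, hle⟩ := hdom.exists_weights
    obtain rfl : V = fun _ => T' := funext fun j => (hV j).1
    have hJ : Nonempty J := by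
      by_contra h
      rw [not_nonempty_iff] at h
      simp at hw
    simp_rw [← Finset.sum_mul, hw, one_mul] at hle
    refine ⟨T', hT' rfl, hwit.of_sum_le ?_, (hV hJ.some).2⟩
    -- With a single weight `1` the sublinearity required of the infimum is an equality.
    simpa using hUI.sum_init_le .min hU₁ hU₂ hι (J := Unit) (w := 1) (V := fun _ => T')
      (by simp) (by simp) (by simpa using hle)
  · intro hwit hdom
    obtain ⟨J, _, w, V, hw, hV, hle⟩ := hdom.exists_weights
    have hJ : Nonempty J := by
      by_contra h
      rw [not_nonempty_iff] at h
      simp at hw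
    -- The largest of the averaged probabilities is at least their weighted average.
    obtain ⟨j, -, hj⟩ := Finset.exists_max_image (Finset.univ : Finset J)
      (fun j => ∑ s, M.ι s * M.subValue .max (S₁ ∪ V j) s) Finset.univ_nonempty
    refine ⟨V j, (hV j).1, hwit.of_sum_le ?_, (hV j).2⟩
    calc ∑ s, M.ι s * M.subValue .max (S₁ ∪ S₂) s
        ≤ ∑ i, w i * ∑ s, M.ι s * M.subValue .max (S₁ ∪ V i) s :=
          hUI.sum_init_le .max hU₁ hU₂ hι hw (fun _ _ => Opt.opt_max_sum_mul_le _ _) hle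
      _ ≤ ∑ i, w i * ∑ s, M.ι s * M.subValue .max (S₁ ∪ V j) s :=
          Finset.sum_le_sum fun i hi => mul_le_mul_right (hj i hi) _
      _ = ∑ s, M.ι s * M.subValue .max (S₁ ∪ V j) s := by rw [← Finset.sum_mul, hw, one_mul]
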